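/- Let $(X,\rho)$ be a complete CAT$(-1)$ space, that is, a complete metric space in which any two points are joined by a geodesic segment (an isometric copy of a compact interval) and in which every geodesic triangle $\triangle$ satisfies the CAT$(-1)$ inequality: if $\bar\triangle$ is a comparison triangle of $\triangle$ (a geodesic triangle with the same side lengths) in the hyperbolic plane $\mathbb{H}^2$ of constant curvature $-1$, then $\rho(a,b)\le d_{\mathbb{H}^2}(\bar a,\bar b)$ for all $a,b\in\triangle$ and all comparison points $\bar a,\bar b\in\bar\triangle$ of $a,b$ (points on the corresponding sides at the same distances from the corresponding vertices). Let $K\subseteq X$ be nonempty, closed and convex, where convex means that $K$ contains every geodesic segment joining two of its points. Then the following are equivalent: (i) $K$ has the fixed point property for nonexpansive mappings: every map $T\colon K\to K$ with $\rho(Tx,Ty)\le\rho(x,y)$ for all $x,y\in K$ has a point $x\in K$ with $Tx=x$; (ii) $K$ is geodesically bounded: there is no isometric embedding $c\colon[0,\infty)\to X$ with $c([0,\infty))\subseteq K$. -/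

import Mathlib

open scoped UpperHalfPlane NNReal

namespace CATNegOne

/-- `S` is a metric (geodesic) segment joining `x` to `y`: the image of an isometric embedding of
the interval `[0, dist x y]` that starts at `x` and ends at `y`. -/
def IsSegment {X : Type*} [MetricSpace X] (x y : X) (S : Set X) : Prop :=
  ∃ c : ℝ → X, c 0 = x ∧ c (dist x y) = y ∧
    (∀ s ∈ Set.Icc 0 (dist x y), ∀ t ∈ Set.Icc 0 (dist x y), dist (c s) (c t) = |s - t|) ∧
    c '' Set.Icc 0 (dist x y) = S

/-- Any two points are joined by a metric segment. -/
def IsGeodesicSpace (X : Type*) [MetricSpace X] : Prop :=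
  ∀ x y : X, ∃ S : Set X, IsSegment x y S

/-- A geodesic triangle: three vertices and a choice of three edges. -/
structure GeodesicTriangle (X : Type*) [MetricSpace X] where
  (x y z : X)
  (xy yz zx : Set X)
  isSegment_xy : IsSegment x y xy
  isSegment_yz : IsSegment y z yz
  isSegment_zx : IsSegment z x zx

namespace GeodesicTriangle

variable {X Y : Type*} [MetricSpace X] [MetricSpace Y]

/-- The triangle as a set: the union of its edges. -/
def carrier (Δ : GeodesicTriangle X) : Set X := Δ.xy ∪ Δ.yz ∪ Δ.zx

/-- `Δ'` is a comparison triangle of `Δ`: corresponding edges have the same lengths. -/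
def IsComparison (Δ : GeodesicTriangle X) (Δ' : GeodesicTriangle Y) : Prop :=
  dist Δ'.x Δ'.y = dist Δ.x Δ.y ∧ dist Δ'.y Δ'.z = dist Δ.y Δ.z ∧ dist Δ'.z Δ'.x = dist Δ.z Δ.x

/-- `a'` is a comparison point in `Δ'` of the point `a` of `Δ`: it lies on the corresponding edge,
at the same distance from the initial vertex of that edge. -/
def IsComparisonPoint (Δ : GeodesicTriangle X) (Δ' : GeodesicTriangle Y) (a : X) (a' : Y) : Prop :=
  (a ∈ Δ.xy ∧ a' ∈ Δ'.xy ∧ dist Δ'.x a' = dist Δ.x a) ∨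
  (a ∈ Δ.yz ∧ a' ∈ Δ'.yz ∧ dist Δ'.y a' = dist Δ.y a) ∨
  (a ∈ Δ.zx ∧ a' ∈ Δ'.zx ∧ dist Δ'.z a' = dist Δ.z a)

/-- The CAT(-1) inequality. The model plane of constant curvature `-1` is the hyperbolic plane,
realized as the upper half-plane `ℍ` with its Poincaré metric. -/
def SatisfiesCATNegOne (Δ : GeodesicTriangle X) : Prop :=
  ∀ Δ' : GeodesicTriangle ℍ, Δ.IsComparison Δ' →
    ∀ a ∈ Δ.carrier, ∀ b ∈ Δ.carrier, ∀ a' ∈ Δ'.carrier, ∀ b' ∈ Δ'.carrier,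
      Δ.IsComparisonPoint Δ' a a' → Δ.IsComparisonPoint Δ' b b' → dist a b ≤ dist a' b'

end GeodesicTriangle

/-- A CAT(-1) space: a geodesic space all of whose geodesic triangles satisfy the CAT(-1)
inequality. -/
def IsCATNegOne (X : Type*) [MetricSpace X] : Prop :=
  IsGeodesicSpace X ∧ ∀ Δ : GeodesicTriangle X, Δ.SatisfiesCATNegOne

/-- `K` contains every metric segment joining two of its points. -/
def IsGeodesicallyConvex {X : Type*} [MetricSpace X] (K : Set X) : Prop :=
  ∀ x ∈ K, ∀ y ∈ K, ∀ S : Set X, IsSegment x y S → S ⊆ K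

/-- `K` contains no geodesic ray, that is, no isometric copy of `[0, ∞)`. -/
def IsGeodesicallyBounded {X : Type*} [MetricSpace X] (K : Set X) : Prop :=
  ¬ ∃ c : ℝ≥0 → X, Isometry c ∧ ∀ t, c t ∈ K

/-- Every nonexpansive self-map of `K` has a fixed point. -/
def HasFixedPointProperty {X : Type*} [MetricSpace X] (K : Set X) : Prop :=
  ∀ T : K → K, (∀ x y : K, dist (T x) (T y) ≤ dist x y) → ∃ x : K, T x = x

end CATNegOne

namespace CATNegOne

open Real

/-! ### Inequalities for hyperbolic functions -/

/-! A ray `c` in `K` gives the nonexpansive map `x ↦ c (max (-b x) 0 + 1)`, with `b` its Busemann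
function; it shifts the ray by one and so fixes nothing.

Conversely, fix `p ∈ K`. Following `T` by contraction towards `p` with factor `(1 + ε)⁻¹` gives a
strict contraction (`dist_contract_le`), whose Banach fixed point `x` lies on `[p, T x]`. Compare
two such points, at distances `a` and `b` from `p`, with parameters `δ ≥ ε`. By CAT(-1) and the law
of cosines, `T x` and `T y` can be no farther apart than `x` and `y` only if `a ≤ b` and the
comparison angle `θ` at `p` satisfies `(1 - cos θ) cosh a sinh b ≤ sinh (b - a)`.

Hence along `ε = 1 / (n + 1)` the distances `a n` increase. If they are bounded, the points form a
Cauchy sequence whose limit is fixed by `T`. If not, the angles close like `1 / cosh (a n)`, and the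
segments from `p` converge to a ray in `K`. -/

theorem cosh_add_mul_sinh_le (u v : ℝ) : cosh u + (v - u) * sinh u ≤ cosh v := by
  have h1 : exp u * (v - u + 1) ≤ exp v := by
    calc exp u * (v - u + 1) ≤ exp u * exp (v - u) := by
          gcongr; exact add_one_le_exp _
      _ = exp v := by rw [← exp_add]; congr 1; ring
  have h2 : exp (-u) * (u - v + 1) ≤ exp (-v) := by
    calc exp (-u) * (u - v + 1) ≤ exp (-u) * exp (u - v) := by
          gcongr; exact add_one_le_exp _
      _ = exp (-v) := by rw [← exp_add]; congr 1; ring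
  rw [cosh_eq, cosh_eq, sinh_eq]
  linarith

theorem sinh_add_mul_cosh_le {a b : ℝ} (ha : 0 ≤ a) (hab : a ≤ b) :
    sinh a + (b - a) * cosh a ≤ sinh b := by
  have h : sinh b = sinh a * cosh (b - a) + cosh a * sinh (b - a) := by
    rw [← sinh_add]; congr 1; ring
  have h1 := one_le_cosh (b - a)
  have h2 : b - a ≤ sinh (b - a) := self_le_sinh_iff.2 (by linarith)
  have h3 := sinh_nonneg_iff.2 ha
  have h4 := cosh_pos a
  rw [h]
  nlinarith [mul_le_mul_of_nonneg_left h1 h3, mul_le_mul_of_nonneg_left h2 h4.le]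

theorem sq_le_two_mul_cosh_sub_one (d : ℝ) : d ^ 2 ≤ 2 * (cosh d - 1) := by
  have h : cosh d = 1 + 2 * sinh (d / 2) ^ 2 := by
    have := cosh_two_mul (d / 2)
    rw [cosh_sq, mul_div_cancel₀ d two_ne_zero] at this
    linarith
  have h2 : (d / 2) ^ 2 ≤ sinh (d / 2) ^ 2 := by
    rw [sq_le_sq, abs_sinh]
    exact self_le_sinh_iff.2 (abs_nonneg _)
  rw [h]
  linarith

theorem sinh_mul_le {s x : ℝ} (hs : 0 ≤ s) (hs1 : s ≤ 1) (hx : 0 ≤ x) :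
    sinh (s * x) ≤ s * sinh x := by
  have hd : ∀ x, HasDerivAt (fun x => s * sinh x - sinh (s * x))
      (s * cosh x - cosh (s * x) * (s * 1)) x := fun x =>
    ((hasDerivAt_sinh x).const_mul s).sub (((hasDerivAt_id x).const_mul s).sinh)
  have hm : MonotoneOn (fun x => s * sinh x - sinh (s * x)) (Set.Ici 0) := by
    refine monotoneOn_of_deriv_nonneg (convex_Ici 0)
      (fun x _ => (hd x).continuousAt.continuousWithinAt)
      (fun x _ => (hd x).differentiableAt.differentiableWithinAt) fun x hx => ?_
    rw [interior_Ici] at hx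
    rw [(hd x).deriv]
    have : cosh (s * x) ≤ cosh x := by
      rw [cosh_le_cosh, abs_mul, abs_of_nonneg hs]
      exact mul_le_of_le_one_left (abs_nonneg _) hs1
    nlinarith
  have := hm (Set.mem_Ici.2 le_rfl) (Set.mem_Ici.2 hx) hx
  simp only [sinh_zero, mul_zero, sub_zero] at this
  linarith

theorem sinh_mul_mul_sinh_le {t x y : ℝ} (ht : 0 ≤ t) (ht1 : t ≤ 1) (hx : 0 ≤ x) (hxy : x ≤ y) :
    sinh (t * y) * sinh x ≤ sinh (t * x) * sinh y := by
  rcases hx.eq_or_lt with rfl | hx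
  · simp
  have hd : ∀ z ∈ Set.Ioi (0 : ℝ), HasDerivAt (fun z => sinh (t * z) / sinh z)
      ((cosh (t * z) * (t * 1) * sinh z - sinh (t * z) * cosh z) / sinh z ^ 2) z := fun z hz =>
    (((hasDerivAt_id z).const_mul t).sinh).div (hasDerivAt_sinh z) (sinh_pos_iff.2 hz).ne'
  have ha : AntitoneOn (fun z => sinh (t * z) / sinh z) (Set.Ioi 0) := by
    refine antitoneOn_of_deriv_nonpos (convex_Ioi 0)
      (fun z hz => (hd z hz).continuousAt.continuousWithinAt)
      (fun z hz => (hd z (interior_subset hz)).differentiableAt.differentiableWithinAt)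
      fun z hz => ?_
    have hz : 0 < z := interior_subset hz
    rw [(hd z hz).deriv]
    refine div_nonpos_of_nonpos_of_nonneg ?_ (sq_nonneg _)
    -- The numerator of the derivative equals `sinh ((1 - t) z) - (1 - t) sinh z cosh (t z)`.
    have h1 := sinh_mul_le (s := 1 - t) (by linarith) (by linarith) hz.le
    have h2 : sinh ((1 - t) * z) = sinh z * cosh (t * z) - cosh z * sinh (t * z) := by
      rw [← sinh_sub]; congr 1; ring
    have h3 := one_le_cosh (t * z)
    have h4 := sinh_pos_iff.2 hz
    have h5 : (1 - t) * sinh z * 1 ≤ (1 - t) * sinh z * cosh (t * z) :=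
      mul_le_mul_of_nonneg_left h3 (mul_nonneg (by linarith) h4.le)
    nlinarith
  have := ha (Set.mem_Ioi.2 hx) (Set.mem_Ioi.2 (hx.trans_le hxy)) hxy
  simp only at this
  rwa [div_le_div_iff₀ (sinh_pos_iff.2 (hx.trans_le hxy)) (sinh_pos_iff.2 hx)] at this

/-- The tangent line inequality for the concave function `u ↦ cosh (t * arcosh u)`. -/
theorem sinh_mul_cosh_mul_sub_le {t α D : ℝ} (ht : 0 ≤ t) (ht1 : t ≤ 1) (hα : 0 ≤ α) (hD : 0 ≤ D) :
    sinh D * (cosh (t * α) - cosh (t * D)) ≤ t * sinh (t * D) * (cosh α - cosh D) := by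
  -- The claim is that `φ` is minimal at `D`: by `sinh_mul_mul_sinh_le`, its derivative changes sign
  -- there.
  set φ : ℝ → ℝ := fun z => t * sinh (t * D) * cosh z - sinh D * cosh (t * z) with hφ
  have hd : ∀ z, HasDerivAt φ
      (t * sinh (t * D) * sinh z - sinh D * (sinh (t * z) * (t * 1))) z := fun z =>
    ((hasDerivAt_cosh z).const_mul _).sub ((((hasDerivAt_id z).const_mul t).cosh).const_mul _)
  suffices h : φ D ≤ φ α by
    simp only [hφ] at h
    linarith
  rcases le_total α D with h | h
  · refine antitoneOn_of_deriv_nonpos (convex_Icc 0 D)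
      (fun z hz => (hd z).continuousAt.continuousWithinAt)
      (fun z hz => (hd z).differentiableAt.differentiableWithinAt)
      (fun z hz => ?_) ⟨hα, h⟩ ⟨hD, le_rfl⟩ h
    have hz := interior_subset hz
    rw [(hd z).deriv]
    nlinarith [mul_le_mul_of_nonneg_left (sinh_mul_mul_sinh_le ht ht1 hz.1 hz.2) ht]
  · refine monotoneOn_of_deriv_nonneg (convex_Ici D)
      (fun z hz => (hd z).continuousAt.continuousWithinAt)
      (fun z hz => (hd z).differentiableAt.differentiableWithinAt)
      (fun z hz => ?_) (Set.mem_Ici.2 le_rfl) h h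
    have hz := interior_subset hz
    rw [(hd z).deriv]
    nlinarith [mul_le_mul_of_nonneg_left (sinh_mul_mul_sinh_le ht ht1 hD hz) ht]

/-- Contracting two sides of a hyperbolic triangle by the factor `t ≤ 1` towards their common
vertex contracts the third side at least by the factor `t`. The number `k` stands for
`1 - cos θ`, where `θ` is the angle at that vertex. -/
theorem cosh_third_side_le {t A B D k : ℝ} (ht : 0 ≤ t) (ht1 : t ≤ 1) (hA : 0 ≤ A) (hB : 0 ≤ B)
    (hD : 0 < D) (hk : 0 ≤ k) (hk2 : k ≤ 2)
    (h : cosh D = cosh (A - B) + k * (sinh A * sinh B)) :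
    cosh (t * A - t * B) + k * (sinh (t * A) * sinh (t * B)) ≤ cosh (t * D) := by
  -- A convex combination whose weights do not depend on the radii. Both arguments scale by `t`, so
  -- the tangent inequalities at `D` can be averaged.
  have key : ∀ x y : ℝ, cosh (x - y) + k * (sinh x * sinh y) =
      (1 - k / 2) * cosh |x - y| + k / 2 * cosh (x + y) := fun x y => by
    rw [cosh_abs, cosh_add, cosh_sub]; ring
  have e : |t * A - t * B| = t * |A - B| := by
    rw [← mul_sub, abs_mul, abs_of_nonneg ht]
  rw [key] at h ⊢
  rw [e, ← mul_add]
  have h1 := sinh_mul_cosh_mul_sub_le ht ht1 (abs_nonneg (A - B)) hD.le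
  have h2 := sinh_mul_cosh_mul_sub_le ht ht1 (add_nonneg hA hB) hD.le
  have h3 := mul_le_mul_of_nonneg_left h1 (show 0 ≤ 1 - k / 2 by linarith)
  have h4 := mul_le_mul_of_nonneg_left h2 (show 0 ≤ k / 2 by linarith)
  have h5 : sinh D * ((1 - k / 2) * cosh (t * |A - B|) + k / 2 * cosh (t * (A + B))
      - cosh (t * D)) ≤ sinh D * 0 := by
    have h6 : t * sinh (t * D) * ((1 - k / 2) * cosh |A - B| + k / 2 * cosh (A + B) - cosh D) = 0 := by
      rw [h]; ring
    linarith
  linarith [le_of_mul_le_mul_left h5 (sinh_pos_iff.2 hD)]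

/-- If `b < a`, the larger radius gets the larger factor: the radial gap strictly grows and the
angular term does not shrink, so the distance would increase. -/
theorem le_of_cosh_add_le {a b δ ε k : ℝ} (ha : 0 < a) (hb : 0 < b) (hε : 0 < ε) (hεδ : ε ≤ δ)
    (hk : 0 ≤ k)
    (h : cosh ((1 + δ) * a - (1 + ε) * b) + k * (sinh ((1 + δ) * a) * sinh ((1 + ε) * b)) ≤
      cosh (a - b) + k * (sinh a * sinh b)) : a ≤ b := by
  by_contra! hba
  have h1 : k * (sinh a * sinh b) ≤ k * (sinh ((1 + δ) * a) * sinh ((1 + ε) * b)) := by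
    have := sinh_nonneg_iff.2 ha.le
    have := sinh_nonneg_iff.2 hb.le
    have : sinh a ≤ sinh ((1 + δ) * a) := sinh_le_sinh.2 (by nlinarith)
    have : sinh b ≤ sinh ((1 + ε) * b) := sinh_le_sinh.2 (by nlinarith)
    have : 0 ≤ sinh ((1 + δ) * a) := by linarith
    gcongr
  have h2 : cosh (a - b) < cosh ((1 + δ) * a - (1 + ε) * b) := by
    have : a - b < (1 + δ) * a - (1 + ε) * b := by nlinarith
    rw [cosh_lt_cosh, abs_of_pos (by linarith), abs_of_pos (by linarith)]
    exact this
  linarith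

/-- To first order, the angular term gains at least `δ a k cosh a sinh b`, while by convexity of
`cosh` the radial term loses at most `δ a sinh (b - a)`. -/
theorem mul_cosh_mul_sinh_le {a b δ ε k : ℝ} (ha : 0 < a) (hb : 0 < b) (hε : 0 < ε) (hεδ : ε ≤ δ)
    (hk : 0 ≤ k) (hab : a ≤ b)
    (h : cosh ((1 + δ) * a - (1 + ε) * b) + k * (sinh ((1 + δ) * a) * sinh ((1 + ε) * b)) ≤
      cosh (a - b) + k * (sinh a * sinh b)) : k * (cosh a * sinh b) ≤ sinh (b - a) := by
  have hδa : 0 < δ * a := mul_pos (by linarith) ha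
  have hsb := sinh_nonneg_iff.2 hb.le
  have h1 : sinh a + δ * a * cosh a ≤ sinh ((1 + δ) * a) := by
    have := sinh_add_mul_cosh_le ha.le (show a ≤ (1 + δ) * a by linarith)
    linarith
  have h2 : sinh b ≤ sinh ((1 + ε) * b) := sinh_le_sinh.2 (by nlinarith)
  have h3 : (sinh a + δ * a * cosh a) * sinh b ≤ sinh ((1 + δ) * a) * sinh ((1 + ε) * b) := by
    have : 0 ≤ sinh ((1 + δ) * a) := sinh_nonneg_iff.2 (by linarith)
    gcongr
  have h4 := mul_le_mul_of_nonneg_left h3 hk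
  have h5 := cosh_add_mul_sinh_le (b - a) ((1 + ε) * b - (1 + δ) * a)
  rw [← cosh_neg, neg_sub] at h
  rw [← cosh_neg (a - b), neg_sub] at h
  have h6 : 0 ≤ ε * b * sinh (b - a) :=
    mul_nonneg (mul_nonneg hε.le hb.le) (sinh_nonneg_iff.2 (by linarith))
  have h7 : δ * a * (k * (cosh a * sinh b)) ≤ δ * a * sinh (b - a) := by linarith
  exact le_of_mul_le_mul_left h7 hδa

end CATNegOne

namespace CATNegOne

open Real

/-! ### Polar coordinates in the hyperbolic plane -/

theorem cosh_sub_sinh_mul_cos_pos (θ r : ℝ) : 0 < cosh r - sinh r * cos θ := by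
  have h : |sinh r * cos θ| < cosh r := by
    rw [abs_mul]
    calc |sinh r| * |cos θ| ≤ |sinh r| * 1 := by
          gcongr; exact abs_cos_le_one θ
      _ < cosh r := by
          rw [mul_one, ← abs_of_pos (cosh_pos r), ← sq_lt_sq, cosh_sq]; linarith
  linarith [le_abs_self (sinh r * cos θ)]

/-- The point of the hyperbolic plane with polar coordinates `(r, θ)` around `i`. -/
noncomputable def polarPoint (θ r : ℝ) : ℍ :=
  ⟨⟨sinh r * sin θ / (cosh r - sinh r * cos θ), 1 / (cosh r - sinh r * cos θ)⟩,
    one_div_pos.2 (cosh_sub_sinh_mul_cos_pos θ r)⟩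

theorem polarPoint_zero (θ θ' : ℝ) : polarPoint θ 0 = polarPoint θ' 0 := by
  simp [polarPoint]

/-- The hyperbolic law of cosines. -/
theorem cosh_dist_polarPoint (θ φ r s : ℝ) :
    cosh (dist (polarPoint θ r) (polarPoint φ s)) =
      cosh (r - s) + (1 - cos (θ - φ)) * (sinh r * sinh s) := by
  have h1 := cosh_sub_sinh_mul_cos_pos θ r
  have h2 := cosh_sub_sinh_mul_cos_pos φ s
  rw [UpperHalfPlane.cosh_dist, Complex.dist_eq_re_im, sq_sqrt (by positivity), cosh_sub, cos_sub]
  simp only [polarPoint, UpperHalfPlane.mk_im]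
  have a1 : cosh r ^ 2 = sinh r ^ 2 + 1 := cosh_sq r
  have a2 : cosh s ^ 2 = sinh s ^ 2 + 1 := cosh_sq s
  have a3 : sin θ ^ 2 = 1 - cos θ ^ 2 := sin_sq θ
  have a4 : sin φ ^ 2 = 1 - cos φ ^ 2 := sin_sq φ
  generalize cosh r = C at *
  generalize sinh r = S at *
  generalize cosh s = C' at *
  generalize sinh s = S' at *
  generalize cos θ = c at *
  generalize sin θ = d at *
  generalize cos φ = c' at *
  generalize sin φ = d' at *
  have h1' := h1.ne'
  have h2' := h2.ne'
  field_simp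
  linear_combination (S ^ 2 * (C' - S' * c') ^ 2) * a3 + (S' ^ 2 * (C - S * c) ^ 2) * a4 -
    (C' - S' * c') ^ 2 * a1 - (C - S * c) ^ 2 * a2

theorem cosh_eq_cosh_iff_abs {x y : ℝ} : cosh x = cosh y ↔ |x| = |y| := by
  simp only [le_antisymm_iff, cosh_le_cosh]

theorem dist_polarPoint (θ r s : ℝ) : dist (polarPoint θ r) (polarPoint θ s) = |r - s| := by
  have h := cosh_dist_polarPoint θ θ r s
  rw [sub_self, cos_zero, sub_self, zero_mul, add_zero] at h
  have h' := cosh_eq_cosh_iff_abs.1 h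
  rwa [abs_of_nonneg dist_nonneg] at h'

theorem exists_polarPoint_eq (w : ℍ) : ∃ θ r : ℝ, 0 ≤ r ∧ polarPoint θ r = w := by
  have hy := w.im_pos
  set x := w.re
  set y := w.im
  -- This is `sinh r * exp (iθ)`, found by solving the formulas of `polarPoint` for `r` and `θ`.
  set z : ℂ := ⟨(x ^ 2 + y ^ 2 - 1) / (2 * y), x / y⟩ with hz
  have hn : ‖z‖ ^ 2 = ((x ^ 2 + y ^ 2 - 1) / (2 * y)) ^ 2 + (x / y) ^ 2 := by
    rw [Complex.sq_norm, Complex.normSq_apply]; ring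
  have hc : cosh (arsinh ‖z‖) = (1 + x ^ 2 + y ^ 2) / (2 * y) := by
    rw [cosh_arsinh, hn, sqrt_eq_iff_mul_self_eq (by positivity) (by positivity)]
    field_simp
    ring
  have h1 : ‖z‖ * cos z.arg = (x ^ 2 + y ^ 2 - 1) / (2 * y) := Complex.norm_mul_cos_arg z
  have h2 : ‖z‖ * sin z.arg = x / y := Complex.norm_mul_sin_arg z
  refine ⟨z.arg, arsinh ‖z‖, arsinh_nonneg_iff.2 (norm_nonneg _), ?_⟩
  have h3 : (1 + x ^ 2 + y ^ 2) / (2 * y) - (x ^ 2 + y ^ 2 - 1) / (2 * y) = 1 / y := by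
    field_simp; ring
  apply UpperHalfPlane.ext
  apply Complex.ext
  · simp only [polarPoint, sinh_arsinh, hc, h1, h2, h3]
    change x / y / (1 / y) = x
    field_simp
  · simp only [polarPoint, sinh_arsinh, hc, h1, h3]
    change 1 / (1 / y) = y
    field_simp

/-! ### Segments -/

section Segment

variable {X Y : Type*} [MetricSpace X] [MetricSpace Y]

/-- `c` parametrizes a segment from `x` to `y` by arc length. -/
def IsGeodesicFromTo (c : ℝ → X) (x y : X) : Prop :=
  c 0 = x ∧ c (dist x y) = y ∧
    ∀ s ∈ Set.Icc 0 (dist x y), ∀ t ∈ Set.Icc 0 (dist x y), dist (c s) (c t) = |s - t|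

namespace IsGeodesicFromTo

variable {c : ℝ → X} {x y : X}

theorem isSegment (h : IsGeodesicFromTo c x y) : IsSegment x y (c '' Set.Icc 0 (dist x y)) :=
  ⟨c, h.1, h.2.1, h.2.2, rfl⟩

theorem dist_left (h : IsGeodesicFromTo c x y) {s : ℝ} (hs : s ∈ Set.Icc 0 (dist x y)) :
    dist x (c s) = s := by
  rw [← h.1, h.2.2 0 ⟨le_rfl, dist_nonneg⟩ s hs, zero_sub, abs_neg, abs_of_nonneg hs.1]

theorem dist_right (h : IsGeodesicFromTo c x y) {s : ℝ} (hs : s ∈ Set.Icc 0 (dist x y)) :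
    dist y (c s) = dist x y - s := by
  conv_lhs => rw [← h.2.1]
  rw [h.2.2 _ ⟨dist_nonneg, le_rfl⟩ s hs, abs_of_nonneg (by linarith [hs.2])]

theorem symm (h : IsGeodesicFromTo c x y) : IsGeodesicFromTo (fun s => c (dist x y - s)) y x := by
  refine ⟨by simp [h.2.1], by simp [dist_comm y x, h.1], fun s hs t ht => ?_⟩
  rw [dist_comm y x] at hs ht
  rw [h.2.2 _ ⟨by linarith [hs.2], by linarith [hs.1]⟩ _ ⟨by linarith [ht.2], by linarith [ht.1]⟩,
    sub_sub_sub_cancel_left, abs_sub_comm]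

theorem symm_image : (fun s => c (dist x y - s)) '' Set.Icc 0 (dist y x) =
    c '' Set.Icc 0 (dist x y) := by
  rw [dist_comm y x]
  ext p
  constructor
  · rintro ⟨s, hs, rfl⟩
    exact ⟨dist x y - s, ⟨by linarith [hs.2], by linarith [hs.1]⟩, rfl⟩
  · rintro ⟨s, hs, rfl⟩
    exact ⟨dist x y - s, ⟨by linarith [hs.2], by linarith [hs.1]⟩, by simp⟩

theorem isSegment_symm (h : IsGeodesicFromTo c x y) :
    IsSegment y x (c '' Set.Icc 0 (dist x y)) :=
  symm_image (c := c) ▸ h.symm.isSegment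

theorem map (h : IsGeodesicFromTo c x y) {f : X → Y} (hf : Isometry f) :
    IsGeodesicFromTo (f ∘ c) (f x) (f y) := by
  unfold IsGeodesicFromTo
  simp only [hf.dist_eq, Function.comp_apply]
  exact ⟨congrArg f h.1, congrArg f h.2.1, h.2.2⟩

end IsGeodesicFromTo

theorem IsGeodesicSpace.exists_geodesic (hX : IsGeodesicSpace X) (x y : X) :
    ∃ c : ℝ → X, IsGeodesicFromTo c x y := by
  obtain ⟨S, c, h0, h1, h2, -⟩ := hX x y
  exact ⟨c, h0, h1, h2⟩

theorem isGeodesicFromTo_polarPoint (θ : ℝ) {r : ℝ} (hr : 0 ≤ r) :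
    IsGeodesicFromTo (polarPoint θ) (polarPoint θ 0) (polarPoint θ r) := by
  refine ⟨rfl, ?_, fun s _ t _ => dist_polarPoint θ s t⟩
  rw [dist_polarPoint, zero_sub, abs_neg, abs_of_nonneg hr]

/-- `SL(2, ℝ)` acts transitively by isometries, so radial geodesics from the base point suffice. -/
theorem exists_geodesic_upperHalfPlane (z w : ℍ) : ∃ c : ℝ → ℍ, IsGeodesicFromTo c z w := by
  obtain ⟨g, hg⟩ := MulAction.exists_smul_eq (Matrix.SpecialLinearGroup (Fin 2) ℝ)
    (polarPoint 0 0) z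
  obtain ⟨θ, r, hr, hw⟩ := exists_polarPoint_eq (g⁻¹ • w)
  have h := (isGeodesicFromTo_polarPoint θ hr).map (isometry_smul ℍ g)
  rw [polarPoint_zero θ 0, hg, hw, smul_inv_smul] at h
  exact ⟨_, h⟩

/-- The CAT(-1) inequality for two points on two sides of a triangle, with the comparison distance
expressed by the hyperbolic law of cosines; `1 - k` is the cosine of the comparison angle at `p`. -/
theorem IsCATNegOne.exists_cosh_dist_le (hX : IsCATNegOne X) {p y z : X} {c₁ c₂ : ℝ → X}
    (h₁ : IsGeodesicFromTo c₁ p y) (h₂ : IsGeodesicFromTo c₂ p z) :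
    ∃ k, 0 ≤ k ∧ k ≤ 2 ∧
      cosh (dist y z) = cosh (dist p y - dist p z) + k * (sinh (dist p y) * sinh (dist p z)) ∧
      ∀ a ∈ Set.Icc 0 (dist p y), ∀ b ∈ Set.Icc 0 (dist p z),
        cosh (dist (c₁ a) (c₂ b)) ≤ cosh (a - b) + k * (sinh a * sinh b) := by
  set A := dist p y with hA
  set B := dist p z with hB
  have hA0 : 0 ≤ A := dist_nonneg
  have hB0 : 0 ≤ B := dist_nonneg
  have hlow : |A - B| ≤ dist y z := by
    rw [hA, hB, dist_comm p y, dist_comm p z]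
    exact abs_dist_sub_le y z p
  have hup : dist y z ≤ A + B := by
    rw [hA, dist_comm p y]; exact dist_triangle y p z
  -- The two triangle inequalities correspond to `k = 0` and `k = 2`. If a side at `p` is
  -- degenerate, any `k` works and `0` is taken.
  obtain ⟨k, hk0, hk2, hk⟩ : ∃ k, 0 ≤ k ∧ k ≤ 2 ∧
      cosh (dist y z) = cosh (A - B) + k * (sinh A * sinh B) := by
    have hl : cosh (A - B) ≤ cosh (dist y z) := by
      rwa [cosh_le_cosh, abs_of_nonneg (dist_nonneg (x := y))]
    have hu : cosh (dist y z) ≤ cosh (A + B) := by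
      rwa [cosh_le_cosh, abs_of_nonneg (dist_nonneg (x := y)), abs_of_nonneg (add_nonneg hA0 hB0)]
    have hdiff : cosh (A + B) = cosh (A - B) + 2 * (sinh A * sinh B) := by
      rw [cosh_add, cosh_sub]; ring
    rcases (mul_nonneg (sinh_nonneg_iff.2 hA0) (sinh_nonneg_iff.2 hB0)).eq_or_lt with h0 | hpos
    · exact ⟨0, le_rfl, zero_le_two, by rw [← h0] at hdiff; linarith⟩
    · refine ⟨(cosh (dist y z) - cosh (A - B)) / (sinh A * sinh B),
        div_nonneg (by linarith) hpos.le, by rw [div_le_iff₀ hpos]; linarith, ?_⟩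
      rw [div_mul_cancel₀ _ hpos.ne']; ring
  have hθ : 1 - cos (0 - arccos (1 - k)) = k := by
    rw [zero_sub, cos_neg, cos_arccos (by linarith) (by linarith)]; ring
  set θ := arccos (1 - k)
  refine ⟨k, hk0, hk2, hk, fun a ha b hb => ?_⟩
  obtain ⟨c₃, h₃⟩ := hX.1.exists_geodesic y z
  obtain ⟨c₃', h₃'⟩ := exists_geodesic_upperHalfPlane (polarPoint 0 A) (polarPoint θ B)
  have h₁' := isGeodesicFromTo_polarPoint 0 hA0
  have h₂' := isGeodesicFromTo_polarPoint θ hB0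
  rw [polarPoint_zero θ 0] at h₂'
  have dA : dist (polarPoint 0 0) (polarPoint 0 A) = A := by
    rw [dist_polarPoint, zero_sub, abs_neg, abs_of_nonneg hA0]
  have dB : dist (polarPoint 0 0) (polarPoint θ B) = B := by
    rw [polarPoint_zero 0 θ, dist_polarPoint, zero_sub, abs_neg, abs_of_nonneg hB0]
  have dD : dist (polarPoint 0 A) (polarPoint θ B) = dist y z := by
    have := cosh_dist_polarPoint 0 θ A B
    rw [hθ, ← hk, cosh_eq_cosh_iff_abs, abs_of_nonneg dist_nonneg, abs_of_nonneg dist_nonneg] at this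
    exact this
  have ha' : a ∈ Set.Icc 0 (dist (polarPoint 0 0) (polarPoint 0 A)) := by rwa [dA]
  have hb' : b ∈ Set.Icc 0 (dist (polarPoint 0 0) (polarPoint θ B)) := by rwa [dB]
  let Δ : GeodesicTriangle X := ⟨p, y, z, _, _, _, h₁.isSegment, h₃.isSegment, h₂.isSegment_symm⟩
  let Δ' : GeodesicTriangle ℍ := ⟨polarPoint 0 0, polarPoint 0 A, polarPoint θ B, _, _, _,
    h₁'.isSegment, h₃'.isSegment, h₂'.isSegment_symm⟩
  have hΔ : Δ.IsComparison Δ' := ⟨dA, dD, by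
    change dist (polarPoint θ B) (polarPoint 0 0) = dist z p
    rw [dist_comm, dB, dist_comm z p]⟩
  have hle : dist (c₁ a) (c₂ b) ≤ dist (polarPoint 0 a) (polarPoint θ b) := by
    refine hX.2 Δ Δ' hΔ (c₁ a) (Or.inl (Or.inl ⟨a, ha, rfl⟩)) (c₂ b) (Or.inr ⟨b, hb, rfl⟩)
      (polarPoint 0 a) (Or.inl (Or.inl ⟨a, ha', rfl⟩)) (polarPoint θ b) (Or.inr ⟨b, hb', rfl⟩)
      (Or.inl ⟨⟨a, ha, rfl⟩, ⟨a, ha', rfl⟩, ?_⟩)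
      (Or.inr (Or.inr ⟨⟨b, hb, rfl⟩, ⟨b, hb', rfl⟩, ?_⟩))
    · exact (h₁'.dist_left ha').trans (h₁.dist_left ha).symm
    · refine (h₂'.dist_right hb').trans ((h₂.dist_right hb).trans ?_).symm
      rw [dB]
  calc cosh (dist (c₁ a) (c₂ b)) ≤ cosh (dist (polarPoint 0 a) (polarPoint θ b)) := by
        rwa [cosh_le_cosh, abs_of_nonneg dist_nonneg, abs_of_nonneg dist_nonneg]
    _ = cosh (a - b) + k * (sinh a * sinh b) := by rw [cosh_dist_polarPoint, hθ]

end Segment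

end CATNegOne

namespace CATNegOne

open Real Filter Topology

variable {X : Type*} [MetricSpace X]

/-! ### A ray yields a fixed point free nonexpansive map -/

/-- Minus the Busemann function of a ray `c`. -/
noncomputable def negBusemann (c : ℝ≥0 → X) (x : X) : ℝ := ⨆ t : ℝ≥0, ((t : ℝ) - dist x (c t))

theorem dist_ray {c : ℝ≥0 → X} (hc : Isometry c) (s t : ℝ≥0) :
    dist (c s) (c t) = |(s : ℝ) - t| := by
  rw [hc.dist_eq, NNReal.dist_eq]

theorem bddAbove_negBusemann {c : ℝ≥0 → X} (hc : Isometry c) (x : X) :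
    BddAbove (Set.range fun t : ℝ≥0 => ((t : ℝ) - dist x (c t))) := by
  refine ⟨dist (c 0) x, ?_⟩
  rintro _ ⟨t, rfl⟩
  have h := dist_triangle (c 0) x (c t)
  rw [dist_ray hc] at h
  simp only [NNReal.coe_zero, zero_sub, abs_neg, NNReal.abs_eq] at h
  simp only
  linarith

theorem negBusemann_le_add_dist {c : ℝ≥0 → X} (hc : Isometry c) (x y : X) :
    negBusemann c x ≤ negBusemann c y + dist x y := by
  refine ciSup_le fun t => ?_
  have h1 : (t : ℝ) - dist y (c t) ≤ negBusemann c y := le_ciSup (bddAbove_negBusemann hc y) t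
  have h2 := dist_triangle y x (c t)
  rw [dist_comm y x] at h2
  linarith

theorem negBusemann_ray {c : ℝ≥0 → X} (hc : Isometry c) (s : ℝ≥0) : negBusemann c (c s) = s := by
  apply le_antisymm
  · refine ciSup_le fun t => ?_
    rw [dist_ray hc, abs_sub_comm]
    linarith [le_abs_self ((t : ℝ) - s)]
  · have h : (s : ℝ) - dist (c s) (c s) ≤ negBusemann c (c s) :=
      le_ciSup (bddAbove_negBusemann hc (c s)) s
    rwa [dist_self, sub_zero] at h

theorem HasFixedPointProperty.isGeodesicallyBounded {K : Set X} (hK : HasFixedPointProperty K) :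
    IsGeodesicallyBounded K := by
  rintro ⟨c, hc, hcK⟩
  -- A fixed point would lie on the ray, where `negBusemann` is the parameter; the `+ 1` then gives
  -- a contradiction.
  obtain ⟨x, hx⟩ := hK (fun x => ⟨c ((negBusemann c x).toNNReal + 1), hcK _⟩) fun x y => by
    rw [Subtype.dist_eq, Subtype.dist_eq, dist_ray hc]
    push_cast
    rw [add_sub_add_right_eq_sub, Real.coe_toNNReal', Real.coe_toNNReal']
    refine (abs_max_sub_max_le_abs _ _ _).trans (abs_sub_le_iff.2 ⟨?_, ?_⟩)
    · linarith [negBusemann_le_add_dist hc (x : X) y]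
    · linarith [negBusemann_le_add_dist hc (y : X) x, dist_comm (x : X) y]
  have hx' : c ((negBusemann c x).toNNReal + 1) = x := congrArg Subtype.val hx
  have h := negBusemann_ray hc ((negBusemann c x).toNNReal + 1)
  rw [hx'] at h
  push_cast at h
  linarith [Real.le_coe_toNNReal (negBusemann c x)]

/-! ### Geodesic contraction towards a point -/

theorem IsCATNegOne.dist_contract_le (hX : IsCATNegOne X) {p : X} {γ : X → ℝ → X}
    (hγ : ∀ y, IsGeodesicFromTo (γ y) p y) {t : ℝ} (ht : 0 ≤ t) (ht1 : t ≤ 1) (y z : X) :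
    dist (γ y (t * dist p y)) (γ z (t * dist p z)) ≤ t * dist y z := by
  rcases eq_or_ne y z with rfl | hyz
  · simp
  obtain ⟨k, hk0, hk2, hk, hle⟩ := hX.exists_cosh_dist_le (hγ y) (hγ z)
  have mem : ∀ w, t * dist p w ∈ Set.Icc 0 (dist p w) := fun w =>
    ⟨mul_nonneg ht dist_nonneg, mul_le_of_le_one_left dist_nonneg ht1⟩
  have h := (hle _ (mem y) _ (mem z)).trans
    (cosh_third_side_le ht ht1 dist_nonneg dist_nonneg (dist_pos.2 hyz) hk0 hk2 hk)
  rwa [cosh_le_cosh, abs_of_nonneg dist_nonneg, abs_of_nonneg (mul_nonneg ht dist_nonneg)] at h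

theorem IsGeodesicallyConvex.geodesic_mem {K : Set X} (hK : IsGeodesicallyConvex K) {p y : X}
    {c : ℝ → X} (hc : IsGeodesicFromTo c p y) (hp : p ∈ K) (hy : y ∈ K) {s : ℝ}
    (hs : s ∈ Set.Icc 0 (dist p y)) : c s ∈ K :=
  hK p hp y hy _ hc.isSegment ⟨s, hs, rfl⟩

/-- For a nonexpansive `T` and `ε > 0` there is a point `x` on the segment `[p, T x]` with
`dist p (T x) = (1 + ε) * dist p x`. -/
theorem IsCATNegOne.exists_approx_fixed [CompleteSpace X] (hX : IsCATNegOne X) {K : Set X}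
    (hclosed : IsClosed K) (hconv : IsGeodesicallyConvex K) {T : K → K}
    (hT : ∀ x y : K, dist (T x) (T y) ≤ dist x y) {p : X} (hp : p ∈ K) {γ : X → ℝ → X}
    (hγ : ∀ y, IsGeodesicFromTo (γ y) p y) {ε : ℝ} (hε : 0 < ε) :
    ∃ x : K, dist p (T x) = (1 + ε) * dist p x ∧ γ (T x) (dist p x) = x := by
  have ht : 0 ≤ (1 + ε)⁻¹ := by positivity
  have ht1 : (1 + ε)⁻¹ < 1 := inv_lt_one_of_one_lt₀ (by linarith)
  have mem : ∀ w, (1 + ε)⁻¹ * dist p w ∈ Set.Icc 0 (dist p w) := fun w =>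
    ⟨mul_nonneg ht dist_nonneg, mul_le_of_le_one_left dist_nonneg ht1.le⟩
  have : CompleteSpace K := hclosed.completeSpace_coe
  have : Nonempty K := ⟨⟨p, hp⟩⟩
  let F : K → K := fun x => ⟨γ (T x) ((1 + ε)⁻¹ * dist p (T x)),
    hconv.geodesic_mem (hγ _) hp (T x).2 (mem _)⟩
  have hF : ContractingWith ⟨(1 + ε)⁻¹, ht⟩ F := by
    refine ⟨by exact_mod_cast ht1, LipschitzWith.of_dist_le_mul fun x y => ?_⟩
    exact (hX.dist_contract_le hγ ht ht1.le _ _).trans (mul_le_mul_of_nonneg_left (hT x y) ht)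
  refine ⟨hF.fixedPoint, ?_⟩
  have hx : F hF.fixedPoint = hF.fixedPoint := hF.fixedPoint_isFixedPt
  set x := hF.fixedPoint
  have hx' : γ (T x) ((1 + ε)⁻¹ * dist p (T x)) = x := congrArg Subtype.val hx
  have hd : dist p (x : X) = (1 + ε)⁻¹ * dist p (T x) := by
    conv_lhs => rw [← hx']
    exact (hγ _).dist_left (mem _)
  refine ⟨?_, by rw [hd]; exact hx'⟩
  rw [hd, mul_inv_cancel_left₀ (by positivity)]

/-- Comparison of two points obtained from `IsCATNegOne.exists_approx_fixed`. -/
theorem IsCATNegOne.compare_approx_fixed (hX : IsCATNegOne X) {K : Set X} {T : K → K}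
    (hT : ∀ x y : K, dist (T x) (T y) ≤ dist x y) {p : X} {γ : X → ℝ → X}
    (hγ : ∀ y, IsGeodesicFromTo (γ y) p y) {δ ε : ℝ} (hε : 0 < ε) (hεδ : ε ≤ δ) {x y : K}
    (hx : dist p (T x) = (1 + δ) * dist p x) (hx' : γ (T x) (dist p x) = x)
    (hy : dist p (T y) = (1 + ε) * dist p y) (hy' : γ (T y) (dist p y) = y)
    (hpx : 0 < dist p (x : X)) (hpy : 0 < dist p (y : X)) :
    dist p (x : X) ≤ dist p y ∧
      cosh (dist x y) ≤ exp (dist p (y : X) - dist p x) ∧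
      ∀ r, 0 ≤ r → r ≤ dist p (x : X) →
        cosh (dist (γ (T x) r) (γ (T y) r)) ≤ 1 + sinh r ^ 2 / cosh (dist p (x : X)) := by
  obtain ⟨k, hk0, hk2, hk, hle⟩ := hX.exists_cosh_dist_le (hγ (T x)) (hγ (T y))
  have hax : dist p (x : X) ≤ dist p (T x) := by rw [hx]; nlinarith
  have hay : dist p (y : X) ≤ dist p (T y) := by rw [hy]; nlinarith
  have h1 := hle _ ⟨hpx.le, hax⟩ _ ⟨hpy.le, hay⟩
  rw [hx', hy'] at h1
  have h2 : cosh (dist (T x : X) (T y)) ≤ cosh (dist (x : X) y) := by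
    rw [cosh_le_cosh, abs_of_nonneg dist_nonneg, abs_of_nonneg dist_nonneg]
    exact hT x y
  rw [hk, hx, hy] at h2
  have h3 := h2.trans h1
  have hab := le_of_cosh_add_le hpx hpy hε hεδ hk0 h3
  have hkey := mul_cosh_mul_sinh_le hpx hpy hε hεδ hk0 hab h3
  set a := dist p (x : X)
  set b := dist p (y : X)
  have hsb : 0 < sinh b := sinh_pos_iff.2 hpy
  have hca : 0 < cosh a := cosh_pos a
  refine ⟨hab, ?_, fun r hr hra => ?_⟩
  -- With `sinh a ≤ cosh a`, the bound becomes `cosh (b - a) + sinh (b - a) = exp (b - a)`.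
  · have h4 : k * (sinh a * sinh b) ≤ k * (cosh a * sinh b) := by
      have := (sinh_lt_cosh a).le
      gcongr
    rw [← cosh_neg (a - b), neg_sub] at h1
    rw [← cosh_add_sinh]
    exact h1.trans (by linarith)
  · have h5 : k ≤ 1 / cosh a := by
      rw [le_div_iff₀ hca]
      have h6 : sinh (b - a) ≤ sinh b := sinh_le_sinh.2 (by linarith)
      have h7 : k * cosh a * sinh b ≤ 1 * sinh b := by linarith
      exact le_of_mul_le_mul_right h7 hsb
    have h8 := hle r ⟨hr, hra.trans hax⟩ r ⟨hr, (hra.trans hab).trans hay⟩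
    rw [sub_self, cosh_zero] at h8
    have h9 := mul_le_mul_of_nonneg_right h5 (mul_self_nonneg (sinh r))
    calc _ ≤ _ := h8
      _ ≤ 1 + 1 / cosh a * (sinh r * sinh r) := by linarith
      _ = _ := by ring

/-! ### Fixed points in geodesically bounded sets -/

theorem cauchySeq_of_sq_dist_le {x : ℕ → X} {b : ℕ → ℝ} {N : ℕ}
    (h : ∀ n m, N ≤ n → n ≤ m → dist (x n) (x m) ^ 2 ≤ b n) (hb : Tendsto b atTop (𝓝 0)) :
    CauchySeq x := by
  refine Metric.cauchySeq_iff'.2 fun ε hε => ?_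
  obtain ⟨n, hn, hnN⟩ :=
    ((hb.eventually (gt_mem_nhds (by positivity : 0 < ε ^ 2))).and (eventually_ge_atTop N)).exists
  refine ⟨n, fun m hm => ?_⟩
  rw [dist_comm]
  exact lt_of_pow_lt_pow_left₀ 2 hε.le ((h n m hnN hm).trans_lt hn)

theorem IsGeodesicallyBounded.exists_fixedPoint [CompleteSpace X] (hX : IsCATNegOne X) {K : Set X}
    (hne : K.Nonempty) (hclosed : IsClosed K) (hconv : IsGeodesicallyConvex K)
    (hb : IsGeodesicallyBounded K) {T : K → K} (hT : ∀ x y : K, dist (T x) (T y) ≤ dist x y) :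
    ∃ x, T x = x := by
  obtain ⟨p, hp⟩ := hne
  choose γ hγ using hX.1.exists_geodesic p
  by_contra! hfix
  choose x hx hx' using fun n : ℕ => hX.exists_approx_fixed hclosed hconv hT hp hγ
    (Nat.one_div_pos_of_nat (α := ℝ) (n := n))
  set a : ℕ → ℝ := fun n => dist p (x n : X) with ha
  have hpos : ∀ n, 0 < a n := fun n => by
    refine dist_nonneg.lt_of_ne fun h0 => hfix (x n) (Subtype.ext ?_)
    have h1 := hx n
    rw [← h0, mul_zero] at h1
    rw [← dist_eq_zero.1 h1, ← dist_eq_zero.1 h0.symm]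
  have hcmp := fun n m (hnm : n ≤ m) => hX.compare_approx_fixed hT hγ
    (Nat.one_div_pos_of_nat (α := ℝ)) (Nat.one_div_le_one_div (α := ℝ) hnm)
    (hx n) (hx' n) (hx m) (hx' m) (hpos n) (hpos m)
  have hmono : Monotone a := fun n m hnm => (hcmp n m hnm).1
  rcases tendsto_atTop_of_monotone hmono with htop | ⟨L, hL⟩
  · -- the segments from `p` to `x n` converge to a ray
    have hcauchy : ∀ r : ℝ≥0, CauchySeq fun n => γ (T (x n)) r := fun r => by
      obtain ⟨N, hN⟩ := (htop.eventually_ge_atTop (r : ℝ)).exists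
      refine cauchySeq_of_sq_dist_le (b := fun n => 2 * (sinh r ^ 2 / cosh (a n))) (N := N)
        (fun n m hn hnm => ?_) ?_
      · have h1 := (hcmp n m hnm).2.2 r r.2 (hN.trans (hmono hn))
        have h2 := sq_le_two_mul_cosh_sub_one (dist (γ (T (x n)) r) (γ (T (x m)) r))
        linarith
      · have hc : Tendsto (fun n => cosh (a n)) atTop atTop :=
          tendsto_atTop_mono (fun n => (self_le_sinh_iff.2 (hpos n).le).trans (sinh_lt_cosh _).le)
            htop
        simpa using (hc.const_div_atTop (sinh (r : ℝ) ^ 2)).const_mul 2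
    choose c hc using fun r => cauchySeq_tendsto_of_complete (hcauchy r)
    have hmem : ∀ r : ℝ≥0, ∀ᶠ n in atTop, (r : ℝ) ∈ Set.Icc 0 (dist p (T (x n) : X)) := fun r => by
      filter_upwards [htop.eventually_ge_atTop (r : ℝ)] with n hn
      refine ⟨r.2, hn.trans ?_⟩
      rw [hx n]
      exact le_mul_of_one_le_left (hpos n).le
        (by linarith [Nat.one_div_pos_of_nat (α := ℝ) (n := n)])
    refine hb ⟨c, Isometry.of_dist_eq fun r s => ?_, fun r => ?_⟩
    · refine tendsto_nhds_unique ((hc r).dist (hc s)) (tendsto_const_nhds.congr' ?_)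
      filter_upwards [hmem r, hmem s] with n hr hs
      rw [(hγ _).2.2 _ hr _ hs, NNReal.dist_eq]
    · refine hclosed.mem_of_tendsto (hc r) ?_
      filter_upwards [hmem r] with n hr
      exact hconv.geodesic_mem (hγ _) hp (T (x n)).2 hr
  -- Bounded case: `x n` converges, and `dist (x n) (T (x n)) = a n / (n + 1)` tends to `0`.
  · have hle : ∀ n, a n ≤ L := fun n => hmono.ge_of_tendsto hL n
    have : CompleteSpace K := hclosed.completeSpace_coe
    have hcauchy : CauchySeq x := by
      refine cauchySeq_of_sq_dist_le (b := fun n => 2 * (exp (L - a n) - 1)) (N := 0)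
        (fun n m _ hnm => ?_) ?_
      · have h1 := (hcmp n m hnm).2.1
        have h2 := sq_le_two_mul_cosh_sub_one (dist (x n) (x m))
        have h3 : exp (a m - a n) ≤ exp (L - a n) := exp_le_exp.2 (by linarith [hle m])
        linarith
      · have h1 : Tendsto (fun n => exp (L - a n)) atTop (𝓝 (exp (L - L))) :=
          (continuous_exp.tendsto _).comp (tendsto_const_nhds.sub hL)
        rw [sub_self, exp_zero] at h1
        simpa using (h1.sub_const 1).const_mul 2
    obtain ⟨z, hz⟩ := cauchySeq_tendsto_of_complete hcauchy
    have hTc : Continuous T := (LipschitzWith.mk_one hT).continuous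
    refine hfix z (tendsto_nhds_unique ((hTc.tendsto z).comp hz) ?_)
    refine (tendsto_iff_of_dist ?_).1 hz
    have h0 : Tendsto (fun n : ℕ => 1 / ((n : ℝ) + 1) * a n) atTop (𝓝 0) := by
      simpa using tendsto_one_div_add_atTop_nhds_zero_nat.mul hL
    refine h0.congr fun n => ?_
    have hd := (hγ (T (x n))).dist_right (s := a n) ⟨(hpos n).le, by
      rw [hx n]
      exact le_mul_of_one_le_left (hpos n).le
        (by linarith [Nat.one_div_pos_of_nat (α := ℝ) (n := n)])⟩
    rw [hx' n, hx n] at hd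
    rw [dist_comm, Function.comp_apply, Subtype.dist_eq, hd]
    simp only [ha]
    ring

end CATNegOne

theorem theorem4p1 {X : Type*} [MetricSpace X] [CompleteSpace X] (hX : CATNegOne.IsCATNegOne X)
    (K : Set X) (hne : K.Nonempty) (hclosed : IsClosed K)
    (hconv : CATNegOne.IsGeodesicallyConvex K) :
    CATNegOne.HasFixedPointProperty K ↔ CATNegOne.IsGeodesicallyBounded K :=
  ⟨fun h => h.isGeodesicallyBounded, fun h _ hT => h.exists_fixedPoint hX hne hclosed hconv hT⟩
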